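/- Let $X$ be an infinite topological space. An \emph{open cover} of $X$ means here a countable family $\mathcal U$ of open subsets of $X$ with $\bigcup\mathcal U=X$ and $X\notin\mathcal U$. Such a $\mathcal U$ is an \emph{$n$-cover} ($n\in\mathbb N=\{0,1,2,\dots\}$) if every $F\subseteq X$ with $|F|\le n$ is contained in some $U\in\mathcal U$; an \emph{$\omega$-cover} if every finite $F\subseteq X$ is contained in some $U\in\mathcal U$; a \emph{$\gamma$-cover} if it is infinite and every $x\in X$ belongs to all but finitely many members of $\mathcal U$; and \emph{large} if every $x\in X$ belongs to infinitely many members of $\mathcal U$. Let $\mathcal O_n,\Omega,\Gamma,\Lambda$ denote the collections of all open $n$-covers, open $\omega$-covers, open $\gamma$-covers and large open covers of $X$, respectively. An open cover $\mathcal U$ is \emph{$\omega$-groupable} if either $\mathcal U$ can be partitioned into infinitely many finite covers of $X$, or there is a partition $\mathcal P$ of $\mathcal U$ into finite sets such that $\{\bigcup\mathcal F:\mathcal F\in\mathcal P\}\setminus\{X\}$ is an open $\omega$-cover of $X$. Let $\mathcal O^{\omega\text{-gp}}$ denote the collection of all $\omega$-groupable open covers of $X$. The space $X$ satisfies $\mathsf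 U_{fin}(\Gamma,\Omega)$ if for each sequence $(\mathcal U_n)_{n\in\mathbb N}$ of members of $\Gamma$, none of which contains a finite subcover, there are finite (possibly empty) sets $\mathcal F_n\subseteq\mathcal U_n$ such that $\{\bigcup\mathcal F_n:n\in\mathbb N\}\in\Omega$. For collections $\mathscr A_n$ ($n\in\mathbb N$) and $\mathscr B$ of covers of $X$, in the game $\mathsf G_{fin}(\langle\mathscr A_n\rangle,\mathscr B)$ two players ONE and TWO play an inning for each $n\in\mathbb N$: in the $n$th inning ONE chooses $\mathcal U_n\in\mathscr A_n$, and TWO responds with a finite (possibly empty) set $\mathcal F_n\subseteq\mathcal U_n$. TWO wins if $\bigcup_n\mathcal F_n\in\mathscr B$; otherwise ONE wins. A strategy for ONE must supply a legal move in every position that is reached when ONE follows it. Write $\mathsf G_{fin}(\mathscr A,\mathscr B)$ if $\mathscr A_n=\mathscr A$ for all $n$. \textbf{Theorem.} For every infinite topological space $X$ the following are equivalent: (1) $X$ satisfies $\mathsf U_{fin}(\Gamma,\Omega)$; (2) ONE does not have a winning strategy in $\mathsf G_{fin}(\Omega,\mathcal O^{\omega\text{-gp}})$; (3) ONE does not have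 a winning strategy in $\mathsf G_{fin}(\Lambda,\mathcal O^{\omega\text{-gp}})$; (4) ONE does not have a winning strategy in $\mathsf G_{fin}(\langle\mathcal O_n\rangle,\mathcal O^{\omega\text{-gp}})$. -/

import Mathlib

namespace CoverGames

open Set

/-- Countable families of open sets that cover `X` and do not have `X` itself as a member. -/
def IsOpenCover {X : Type*} [TopologicalSpace X] (U : Set (Set X)) : Prop :=
  U.Countable ∧ (∀ V ∈ U, IsOpen V) ∧ ⋃₀ U = univ ∧ univ ∉ U

/-- The collection `O_n` of open `n`-covers: every set of at most `n` points lies in one member. -/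
def nCovers (X : Type*) [TopologicalSpace X] (n : ℕ) : Set (Set (Set X)) :=
  {U | IsOpenCover U ∧ ∀ F : Finset X, F.card ≤ n → ∃ V ∈ U, (F : Set X) ⊆ V}

/-- The collection `Ω` of open `ω`-covers: every finite set of points lies in one member. -/
def omegaCovers (X : Type*) [TopologicalSpace X] : Set (Set (Set X)) :=
  {U | IsOpenCover U ∧ ∀ F : Finset X, ∃ V ∈ U, (F : Set X) ⊆ V}

/-- The collection `Γ` of open `γ`-covers: infinite open covers such that
every point lies in all but finitely many members. -/
def gammaCovers (X : Type*) [TopologicalSpace X] : Set (Set (Set X)) :=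
  {U | IsOpenCover U ∧ U.Infinite ∧ ∀ x : X, {V ∈ U | x ∉ V}.Finite}

/-- The collection `Λ` of large open covers: every point lies in infinitely many members. -/
def largeCovers (X : Type*) [TopologicalSpace X] : Set (Set (Set X)) :=
  {U | IsOpenCover U ∧ ∀ x : X, {V ∈ U | x ∈ V}.Infinite}

/-- `P` is a partition of the set `U` (into nonempty, pairwise disjoint parts). -/
def IsPartitionOf {α : Type*} (P : Set (Set α)) (U : Set α) : Prop :=
  ∅ ∉ P ∧ P.PairwiseDisjoint id ∧ ⋃₀ P = U

/-- `U` can be partitioned into infinitely many finite covers of `X`. -/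
def IsMultifinite {X : Type*} (U : Set (Set X)) : Prop :=
  ∃ P : Set (Set (Set X)), IsPartitionOf P U ∧ P.Infinite ∧ ∀ F ∈ P, F.Finite ∧ ⋃₀ F = univ

/-- The collection of `ω`-groupable open covers: those that are multifinite, or that have
a partition `P` into finite sets such that `{⋃ F : F ∈ P} \ {X}` is an open `ω`-cover. -/
def omegaGroupableCovers (X : Type*) [TopologicalSpace X] : Set (Set (Set X)) :=
  {U | IsOpenCover U ∧
    (IsMultifinite U ∨
      ∃ P : Set (Set (Set X)), IsPartitionOf P U ∧ (∀ F ∈ P, F.Finite) ∧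
        (sUnion '' P) \ {univ} ∈ omegaCovers X)}

/-- The selection hypothesis `U_fin(A, B)`. -/
def Ufin {X : Type*} (A B : Set (Set (Set X))) : Prop :=
  ∀ U : ℕ → Set (Set X),
    (∀ n, U n ∈ A ∧ ¬ ∃ C : Set (Set X), C ⊆ U n ∧ C.Finite ∧ ⋃₀ C = univ) →
    ∃ F : ℕ → Set (Set X), (∀ n, (F n).Finite ∧ F n ⊆ U n) ∧ range (fun n => ⋃₀ F n) ∈ B

/-- The finite sequence `h` of replies of TWO is legal when ONE plays according to `σ`:
the reply in inning `i` is a (finite) subset of the cover that `σ` plays in inning `i`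
in answer to the earlier replies. -/
def LegalHistory {X : Type*} (σ : List (Finset (Set X)) → Set (Set X))
    (h : List (Finset (Set X))) : Prop :=
  ∀ (i : ℕ) (hi : i < h.length), ((h[i] : Finset (Set X)) : Set (Set X)) ⊆ σ (h.take i)

/-- `σ`, which maps the list of the earlier replies of TWO to the next move of ONE, is a strategy
for ONE in the game `G_fin(⟨A_n⟩, B)`: in inning `n` it always plays a member of `A n`. -/
def IsStrategyOne {X : Type*} (A : ℕ → Set (Set (Set X)))
    (σ : List (Finset (Set X)) → Set (Set X)) : Prop :=
  ∀ h : List (Finset (Set X)), LegalHistory σ h → σ h ∈ A h.length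

/-- ONE has a winning strategy in `G_fin(⟨A_n⟩, B)`: a strategy `σ` such that in each infinite play
in which ONE follows `σ`, the union of the replies `T n` of TWO is not a member of `B`. -/
def OneHasWinningStrategy {X : Type*} (A : ℕ → Set (Set (Set X))) (B : Set (Set (Set X))) : Prop :=
  ∃ σ : List (Finset (Set X)) → Set (Set X), IsStrategyOne A σ ∧
    ∀ T : ℕ → Finset (Set X),
      (∀ n, (T n : Set (Set X)) ⊆ σ (List.ofFn fun i : Fin n => T i)) →
      (⋃ n, (T n : Set (Set X))) ∉ B

end CoverGames

/-!
The selection hypothesis `Ufin Γ Ω` is used in the form `SelectsFrequently`: from increasing open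
covers one can select one member each so that every finite set lies in infinitely many of the
selected sets.

For the games in which ONE must lose, it yields two independent facts. First, TWO can defeat any
strategy of ONE in the sense that the sets selected form a *large* cover. The moves of TWO are
encoded as natural numbers `m` ("take the first `m` members"), so the strategy becomes a tree whose
positions carry increasing open covers. In `SelectsFrequently.exists_branch` a branch is found that
gains every point infinitely often: for each position `t` and each `n`, the points gained by every
sequence of `n` moves from `t` on with at least one move `≥ k` form a set that is open, increases
with `k` and exhausts `X`, and selecting `k` from these covers tells how fast a branch must grow.
A member of `Ω`, of `Λ` or of `O_n` has at least `n` members through each point, so TWO may count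
a point as gained in inning `n` only if it lies in `n` of the sets selected there; this makes the
resulting cover large. Second, every large cover `{u 0, u 1, …}` is `ω`-groupable
(`SelectsFrequently.largeCovers_subset`): selecting from the covers `⋃ i ∈ [n, k), u i` gives a
partition of `ℕ` into intervals such that each finite set is covered by infinitely many of them.

Conversely, given `γ`-covers without finite subcovers, ONE plays in inning `n` the sets that are the
intersections of the `k`-th finite unions of the first `n + 1` covers. A group of selected sets
is contained in a finite union from the cover of the first inning that it meets, and only finitely
many groups meet a given inning; so a grouping of the replies of TWO yields the selection sought
(`ufin_of_not_oneHasWinningStrategy`). The three games are compared through `Ω ⊆ Λ` and `Ω ⊆ O_n`.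
-/

namespace CoverGames

open Set Filter

variable {X : Type*} [TopologicalSpace X]

/-! ### Points in many members of a cover -/

theorem exists_finset_avoiding {α : Type*} (S : Finset (Set α)) (hS : ∀ V ∈ S, V ≠ univ) :
    ∃ Y : Finset α, Y.card ≤ S.card ∧ ∀ V ∈ S, ∃ y ∈ Y, y ∉ V := by
  classical
  have h : ∀ V : S, ∃ y, y ∉ (V : Set α) := fun V => (ne_univ_iff_exists_notMem _).1 (hS V V.2)
  choose y hy using h
  refine ⟨S.attach.image y, Finset.card_image_le.trans (by simp), fun V hV => ?_⟩
  exact ⟨y ⟨V, hV⟩, Finset.mem_image_of_mem _ (Finset.mem_attach _ _), hy ⟨V, hV⟩⟩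

theorem omegaCovers_subset_nCovers (n : ℕ) : omegaCovers X ⊆ nCovers X n :=
  fun _ hU => ⟨hU.1, fun F _ => hU.2 F⟩

/-- In an `n`-cover every point lies in at least `n` members: given fewer members containing `x`,
the set formed by `x` and one point outside each of them would not lie in any member. -/
theorem exists_finset_of_mem_nCovers {n : ℕ} {U : Set (Set X)} (hU : U ∈ nCovers X n) (x : X) :
    ∃ S : Finset (Set X), n ≤ S.card ∧ ∀ V ∈ S, V ∈ U ∧ x ∈ V := by
  classical
  obtain ⟨⟨-, -, -, huniv⟩, hn⟩ := hU
  by_cases hfin : {V ∈ U | x ∈ V}.Finite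
  · refine ⟨hfin.toFinset, ?_, fun V hV => by simpa using hV⟩
    by_contra! hlt
    obtain ⟨Y, hYc, hY⟩ := exists_finset_avoiding hfin.toFinset (fun V hV h => by
      rw [Finite.mem_toFinset] at hV
      exact huniv (h ▸ hV.1))
    obtain ⟨V, hVU, hV⟩ := hn (insert x Y) ((Finset.card_insert_le _ _).trans (by omega))
    have hxV : x ∈ V := hV (by simp)
    obtain ⟨y, hyY, hyV⟩ := hY V (by simpa using ⟨hVU, hxV⟩)
    exact hyV (hV (by simp [hyY]))
  · obtain ⟨S, hS, hc⟩ := Set.Infinite.exists_subset_card_eq hfin n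
    exact ⟨S, hc.ge, fun V hV => hS hV⟩

theorem omegaCovers_subset_largeCovers : omegaCovers X ⊆ largeCovers X := by
  refine fun U hU => ⟨hU.1, fun x hfin => ?_⟩
  obtain ⟨S, hc, hS⟩ :=
    exists_finset_of_mem_nCovers (omegaCovers_subset_nCovers (hfin.toFinset.card + 1) hU) x
  have : S ⊆ hfin.toFinset := fun V hV => by simpa using hS V hV
  have := Finset.card_le_card this
  omega

theorem isOpen_setOf_exists_subset_card (S : Finset (Set X)) (hS : ∀ V ∈ S, IsOpen V) (n : ℕ) :
    IsOpen {x : X | ∃ T ⊆ S, n ≤ T.card ∧ ∀ V ∈ T, x ∈ V} := by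
  have : {x : X | ∃ T ⊆ S, n ≤ T.card ∧ ∀ V ∈ T, x ∈ V} =
      ⋃ T ∈ {T : Finset (Set X) | T ⊆ S ∧ n ≤ T.card}, ⋂ V ∈ T, V := by
    ext x
    simp [and_assoc]
  rw [this]
  exact isOpen_biUnion fun T hT => isOpen_biInter_finset fun V hV => hS V (hT.1 hV)

/-! ### Selecting from increasing covers -/

/-- From every sequence of increasing countable open covers of `X` one can select one member each
so that every finite set lies in infinitely many of the selected sets. Unlike in `Ufin`, the
selected sets may be equal to `X` or to one another; what is counted is their indices. -/
def SelectsFrequently (X : Type*) [TopologicalSpace X] : Prop :=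
  ∀ V : ℕ → ℕ → Set X, (∀ n k, IsOpen (V n k)) → (∀ n, Monotone (V n)) →
    (∀ n x, ∃ k, x ∈ V n k) →
    ∃ g : ℕ → ℕ, ∀ F : Finset X, ∃ᶠ n in atTop, (F : Set X) ⊆ V n (g n)

theorem exists_subset_of_monotone {α : Type*} {V : ℕ → Set α} (hmono : Monotone V)
    (hcov : ∀ x, ∃ k, x ∈ V k) (F : Finset α) : ∃ k, (F : Set α) ⊆ V k := by
  choose k hk using hcov
  exact ⟨F.sup k, fun x hx => hmono (Finset.le_sup (f := k) hx) (hk x)⟩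

theorem exists_sUnion_subset_of_monotone {α : Type*} {V : ℕ → Set α} (hmono : Monotone V)
    {C : Set (Set α)} (hC : C.Finite) (hCV : C ⊆ range V) : ∃ k, ⋃₀ C ⊆ V k := by
  choose! k hk using hCV
  refine ⟨hC.toFinset.sup k, sUnion_subset fun S hS => ?_⟩
  rw [← hk hS]
  exact hmono (Finset.le_sup (f := k) (by simpa using hS))

theorem range_mem_gammaCovers {V : ℕ → Set X} (hopen : ∀ k, IsOpen (V k)) (hmono : Monotone V)
    (hcov : ∀ x, ∃ k, x ∈ V k) (hne : ∀ k, V k ≠ univ) :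
    range V ∈ gammaCovers X ∧ ¬ ∃ C : Set (Set X), C ⊆ range V ∧ C.Finite ∧ ⋃₀ C = univ := by
  have hsub : ¬ ∃ C : Set (Set X), C ⊆ range V ∧ C.Finite ∧ ⋃₀ C = univ := by
    rintro ⟨C, hCV, hC, hCu⟩
    obtain ⟨k, hk⟩ := exists_sUnion_subset_of_monotone hmono hC hCV
    exact hne k (univ_subset_iff.1 (hCu ▸ hk))
  have hun : ⋃₀ range V = univ := by
    simpa [sUnion_range, eq_univ_iff_forall] using hcov
  refine ⟨⟨⟨countable_range V, by simpa using hopen, hun, by simpa using hne⟩,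
    fun hfin => hsub ⟨_, Subset.rfl, hfin, hun⟩, fun x => ?_⟩, hsub⟩
  obtain ⟨k, hk⟩ := hcov x
  refine ((finite_Iio k).image V).subset ?_
  rintro _ ⟨⟨i, rfl⟩, hi⟩
  exact ⟨i, lt_of_not_ge fun h => hi (hmono h hk), rfl⟩

theorem selectsFrequently_of_ufin (h : Ufin (gammaCovers X) (omegaCovers X)) :
    SelectsFrequently X := by
  classical
  intro V hopen hmono hcov
  by_cases hA : ∃ᶠ n in atTop, ∃ k, V n k = univ
  · refine ⟨fun n => if hn : ∃ k, V n k = univ then hn.choose else 0,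
      fun F => hA.mono fun n hn => ?_⟩
    simp only [dif_pos hn, hn.choose_spec, subset_univ]
  · rw [not_frequently, eventually_atTop] at hA
    obtain ⟨N, hN⟩ := hA
    push Not at hN
    obtain ⟨C, hC, -, hΩ⟩ := h (fun n => range (V (N + n))) fun n =>
      range_mem_gammaCovers (hopen _) (hmono _) (hcov _) (hN _ (by omega))
    choose g hg using fun n => exists_sUnion_subset_of_monotone (hmono (N + n)) (hC n).1 (hC n).2
    refine ⟨fun n => g (n - N), fun F => frequently_atTop.2 fun M => ?_⟩
    -- One point outside each of the first `M` selected sets forces a later one to be used.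
    have hy : ∀ n, ∃ y, y ∉ V (N + n) (g n) := fun n =>
      (ne_univ_iff_exists_notMem _).1 (hN _ (by omega) _)
    choose y hy using hy
    obtain ⟨_, ⟨n, rfl⟩, hn⟩ := hΩ (F ∪ (Finset.range M).image y)
    have hnV := hn.trans (hg n)
    refine ⟨N + n, ?_, ?_⟩
    · by_contra! hlt
      exact hy n (hnV (by
        simp only [Finset.coe_union, Finset.coe_image, Finset.coe_range]
        exact Or.inr ⟨n, by simp; omega, rfl⟩))
    · simp only [Nat.add_sub_cancel_left]
      exact Subset.trans (by simp) hnV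

/-! ### Infinite plays through a tree of increasing covers -/

/-- The sequence `f (n - 1), …, f 0`: an initial segment of `f`, last entry first. -/
def revPrefix (f : ℕ → ℕ) : ℕ → List ℕ
  | 0 => []
  | n + 1 => f n :: revPrefix f n

theorem length_revPrefix (f : ℕ → ℕ) (n : ℕ) : (revPrefix f n).length = n := by
  induction n with
  | zero => rfl
  | succ n ih => simp [revPrefix, ih]

/-- Positions are finite sequences of natural numbers, last entry first, and `W t m` is the set
gained by the move `m` at the position `t`. A point lies in `guaranteed W k n t` if it is gained
in any `n` successive moves from `t` on of which at least one is `≥ k`. Only the moves below `k`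
and, as `W t` is increasing, the move `k` itself have to be considered, which makes this a finite
intersection. -/
def guaranteed {α : Type*} (W : List ℕ → ℕ → Set α) (k : ℕ) : ℕ → List ℕ → Set α
  | 0, _ => univ
  | n + 1, t => W t k ∩ ⋂ a ∈ Finset.range k, (W t a ∪ guaranteed W k n (a :: t))

theorem isOpen_guaranteed {W : List ℕ → ℕ → Set X} (hopen : ∀ t m, IsOpen (W t m)) (k n : ℕ)
    (t : List ℕ) :
    IsOpen (guaranteed W k n t) := by
  induction n generalizing t with
  | zero => exact isOpen_univ
  | succ n ih =>
    exact (hopen t k).inter (isOpen_biInter_finset fun a _ => (hopen t a).union (ih _))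

theorem guaranteed_mono {α : Type*} {W : List ℕ → ℕ → Set α} (hmono : ∀ t, Monotone (W t))
    (n : ℕ) (t : List ℕ) :
    Monotone fun k => guaranteed W k n t := by
  induction n generalizing t with
  | zero => exact monotone_const
  | succ n ih =>
    rintro k l hkl x ⟨hxk, hx⟩
    refine ⟨hmono t hkl hxk, mem_iInter₂.2 fun a _ => ?_⟩
    rcases lt_or_ge a k with hak | hka
    · exact (mem_iInter₂.1 hx a (Finset.mem_range.2 hak)).imp_right fun h => ih _ hkl h
    · exact Or.inl (hmono t hka hxk)

theorem exists_mem_guaranteed {α : Type*} {W : List ℕ → ℕ → Set α} (hmono : ∀ t, Monotone (W t))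
    (hcov : ∀ t x, ∃ m, x ∈ W t m) (n : ℕ) (t : List ℕ) (x : α) : ∃ k, x ∈ guaranteed W k n t := by
  induction n generalizing t with
  | zero => exact ⟨0, mem_univ x⟩
  | succ n ih =>
    obtain ⟨m, hm⟩ := hcov t x
    choose k hk using fun a => ih (a :: t)
    refine ⟨max m ((Finset.range m).sup k), hmono t (le_max_left _ _) hm,
      mem_iInter₂.2 fun a _ => ?_⟩
    rcases lt_or_ge a m with ham | hma
    · exact Or.inr (guaranteed_mono hmono n _
        ((Finset.le_sup (f := k) (Finset.mem_range.2 ham)).trans (le_max_right _ _)) (hk a))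
    · exact Or.inl (hmono t hma hm)

theorem exists_mem_of_mem_guaranteed {α : Type*} {W : List ℕ → ℕ → Set α}
    (hmono : ∀ t, Monotone (W t)) (f : ℕ → ℕ) {k : ℕ} {x : α} (n j : ℕ)
    (hx : x ∈ guaranteed W k n (revPrefix f j)) (hf : ∃ i < n, k ≤ f (j + i)) :
    ∃ i ≥ j, x ∈ W (revPrefix f i) (f i) := by
  induction n generalizing j with
  | zero => simp at hf
  | succ n ih =>
    rcases le_or_gt k (f j) with hkj | hjk
    · exact ⟨j, le_rfl, hmono _ hkj hx.1⟩
    · rcases mem_iInter₂.1 hx.2 (f j) (Finset.mem_range.2 hjk) with h | h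
      · exact ⟨j, le_rfl, h⟩
      · obtain ⟨i, hin, hi⟩ := hf
        rcases i with _ | i
        · exact absurd hi (by simpa using hjk)
        · obtain ⟨l, hl, hxl⟩ := ih (j + 1) h ⟨i, by omega, by rwa [add_right_comm, add_assoc]⟩
          exact ⟨l, by omega, hxl⟩

/-- If each position of a tree carries an increasing open cover, some branch gains every point
infinitely often. For each position `t` a function `G t` is selected such that any branch
through `t` that grows at least like `G t` from there on gains every point above `t`; the branch
is then taken to obey all the growth conditions imposed by its own initial segments. -/
theorem SelectsFrequently.exists_branch {W : List ℕ → ℕ → Set X} (h : SelectsFrequently X)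
    (hopen : ∀ t m, IsOpen (W t m)) (hmono : ∀ t, Monotone (W t))
    (hcov : ∀ t x, ∃ m, x ∈ W t m) :
    ∃ f : ℕ → ℕ, ∀ x, ∃ᶠ n in atTop, x ∈ W (revPrefix f n) (f n) := by
  choose G hG using fun t => h (fun n k => guaranteed W k (n + 1) t)
    (fun n k => isOpen_guaranteed hopen _ _ _) (fun n => guaranteed_mono hmono _ _)
    (fun n x => exists_mem_guaranteed hmono hcov _ _ x)
  -- `bound p` is the largest value that the initial segments `p.drop i` of `p` ask for.
  let bound : List ℕ → ℕ := fun p => (Finset.range (p.length + 1)).sup fun i => G (p.drop i) i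
  let p : ℕ → List ℕ := fun n => Nat.rec [] (fun _ q => bound q :: q) n
  let f : ℕ → ℕ := fun n => bound (p n)
  have hp : ∀ n, revPrefix f n = p n := fun n => by
    induction n with
    | zero => rfl
    | succ n ih => rw [revPrefix, ih]
  have hdrop : ∀ j n, (p (j + n)).drop n = p j := fun j n => by
    induction n with
    | zero => rfl
    | succ n ih => exact ih
  have hf : ∀ j n, G (revPrefix f j) n ≤ f (j + n) := fun j n => by
    have hmem : n ∈ Finset.range ((p (j + n)).length + 1) := by
      rw [← hp, length_revPrefix, Finset.mem_range]
      omega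
    have := Finset.le_sup (f := fun i => G ((p (j + n)).drop i) i) hmem
    rwa [hdrop, ← hp j] at this
  refine ⟨f, fun x => frequently_atTop.2 fun j => ?_⟩
  obtain ⟨n, hn⟩ := (hG (revPrefix f j) {x}).exists
  exact exists_mem_of_mem_guaranteed hmono f (n + 1) j (hn (by simp)) ⟨n, by omega, hf j n⟩

/-! ### Groupability of large covers -/

theorem exists_mem_Ico_succ {b : ℕ → ℕ} (hb : StrictMono b) (hb0 : b 0 = 0) (n : ℕ) :
    ∃ i, n ∈ Ico (b i) (b (i + 1)) := by
  induction n with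
  | zero => exact ⟨0, hb0.le, lt_of_eq_of_lt hb0.symm (hb Nat.zero_lt_one)⟩
  | succ n ih =>
    obtain ⟨i, hi⟩ := ih
    rcases lt_or_ge (n + 1) (b (i + 1)) with h | h
    · exact ⟨i, hi.1.trans n.le_succ, h⟩
    · exact ⟨i + 1, h, lt_of_le_of_lt hi.2 (hb (i + 1).lt_succ_self)⟩

theorem isPartitionOf_image_Ico {α : Type*} {u : ℕ → α} (hu : Function.Injective u) {b : ℕ → ℕ}
    (hb : StrictMono b) (hb0 : b 0 = 0) :
    IsPartitionOf (range fun i => u '' Ico (b i) (b (i + 1))) (range u) ∧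
      (range fun i => u '' Ico (b i) (b (i + 1))).Infinite := by
  have hdisj : Pairwise (Function.onFun Disjoint fun i => u '' Ico (b i) (b (i + 1))) :=
    fun i j hij => (disjoint_image_iff hu).2 (hb.monotone.pairwise_disjoint_on_Ico_succ hij)
  have hne : ∀ i, (u '' Ico (b i) (b (i + 1))).Nonempty := fun i =>
    (nonempty_Ico.2 (hb i.lt_succ_self)).image u
  refine ⟨⟨?_, ?_, ?_⟩, infinite_range_of_injective fun i j hij => ?_⟩
  · rintro ⟨i, hi⟩
    exact (hne i).ne_empty hi
  · rintro _ ⟨i, rfl⟩ _ ⟨j, rfl⟩ hij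
    exact hdisj fun h => hij (h ▸ rfl)
  · rw [sUnion_range, ← image_iUnion, ← image_univ]
    congr 1
    exact eq_univ_of_forall fun n => mem_iUnion.2 (exists_mem_Ico_succ hb hb0 n)
  · by_contra hne'
    have := hdisj hne'
    simp only [Function.onFun] at this
    rw [hij, disjoint_self] at this
    exact (hne j).ne_empty this

/-- Given any `g`, the intervals of a sufficiently sparse partition of `ℕ` into intervals contain
`[n, g n)` for many `n`: if each finite set is contained in `⋃ i ∈ [n, g n), u i` for infinitely
many `n`, then each finite set is covered by infinitely many intervals. -/
theorem exists_strictMono_frequently {α : Type*} {u : ℕ → Set α} {g : ℕ → ℕ}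
    (hg : ∀ F : Finset α, ∃ᶠ n in atTop, (F : Set α) ⊆ ⋃ i ∈ Ico n (g n), u i) :
    ∃ b : ℕ → ℕ, StrictMono b ∧ b 0 = 0 ∧
      ∀ F : Finset α, ∃ᶠ j in atTop, (F : Set α) ⊆ ⋃ i ∈ Ico (b j) (b (j + 1)), u i := by
  classical
  let a : ℕ → ℕ := fun n => Nat.rec 0 (fun _ c => c + 1 + (Finset.range (c + 1)).sup g) n
  have ha_succ : ∀ n, a (n + 1) = a n + 1 + (Finset.range (a n + 1)).sup g := fun _ => rfl
  have ha : StrictMono a := strictMono_nat_of_lt_succ fun n => by rw [ha_succ]; omega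
  have hag : ∀ n i, n ≤ a i → g n ≤ a (i + 1) := fun n i hni => by
    have := Finset.le_sup (f := g) (Finset.mem_range.2 (Nat.lt_add_one_of_le hni))
    rw [ha_succ]
    exact this.trans (by omega)
  have htwo : ∀ F : Finset α, ∃ᶠ j in atTop, (F : Set α) ⊆ ⋃ i ∈ Ico (a j) (a (j + 2)), u i := by
    refine fun F => frequently_atTop.2 fun N => ?_
    obtain ⟨n, hn, hF⟩ := frequently_atTop.1 (hg F) (a N)
    obtain ⟨i, hlow, hup⟩ := exists_mem_Ico_succ ha rfl n
    have hNi : N < i + 1 := ha.lt_iff_lt.1 (hn.trans_lt hup)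
    exact ⟨i, by omega, hF.trans (biUnion_subset_biUnion_left
      (Ico_subset_Ico hlow (hag n (i + 1) hup.le)))⟩
  -- The intervals `[a j, a (j + 2))` overlap, but those with `j` even do not, nor do those with
  -- `j` odd. If both parities failed, the union of two witnesses would contradict `htwo`.
  by_cases heven : ∀ F : Finset α,
      ∃ᶠ j in atTop, (F : Set α) ⊆ ⋃ i ∈ Ico (a (2 * j)) (a (2 * (j + 1))), u i
  · exact ⟨fun j => a (2 * j), fun i j hij => ha (by omega), rfl, heven⟩
  · -- By truncated subtraction `2 * j - 1` runs through `0, 1, 3, 5, …`.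
    refine ⟨fun j => a (2 * j - 1), fun i j hij => ha (by omega), rfl, fun F => ?_⟩
    obtain ⟨E, hE⟩ := not_forall.1 heven
    rw [not_frequently, eventually_atTop] at hE
    obtain ⟨M, hM⟩ := hE
    refine frequently_atTop.2 fun N => ?_
    obtain ⟨j, hj, hEF⟩ := frequently_atTop.1 (htwo (E ∪ F)) (2 * M + 2 * N)
    rw [Finset.coe_union, union_subset_iff] at hEF
    rcases Nat.even_or_odd' j with ⟨l, rfl | rfl⟩
    · exact absurd hEF.1 (hM l (by omega))
    · refine ⟨l + 1, by omega, ?_⟩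
      have h1 : 2 * (l + 1) - 1 = 2 * l + 1 := by omega
      have h2 : 2 * (l + 1 + 1) - 1 = 2 * l + 1 + 2 := by omega
      simp only [h1, h2]
      exact hEF.2

theorem SelectsFrequently.largeCovers_subset [Nonempty X] (h : SelectsFrequently X) :
    largeCovers X ⊆ omegaGroupableCovers X := by
  rintro U ⟨hU, hlarge⟩
  refine ⟨hU, ?_⟩
  obtain ⟨x₀⟩ := ‹Nonempty X›
  have hinf : U.Infinite := (hlarge x₀).mono (sep_subset _ _)
  obtain ⟨u, hu, rfl⟩ : ∃ u : ℕ → Set X, Function.Injective u ∧ range u = U := by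
    have := hU.1.to_subtype
    have := hinf.to_subtype
    obtain ⟨e⟩ := nonempty_equiv_of_countable (α := ℕ) (β := U)
    exact ⟨fun n => e n, Subtype.val_injective.comp e.injective, by
      rw [show (fun n => (e n : Set X)) = Subtype.val ∘ e from rfl, e.surjective.range_comp,
        Subtype.range_val]⟩
  have hopen : ∀ i, IsOpen (u i) := fun i => hU.2.1 _ ⟨i, rfl⟩
  have hfin : ∀ (b : ℕ → ℕ), ∀ F ∈ range fun i => u '' Ico (b i) (b (i + 1)), F.Finite := by
    rintro b _ ⟨i, rfl⟩
    exact (finite_Ico _ _).image u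
  by_cases hA : ∀ n, ∃ m, ⋃ i ∈ Ico n m, u i = univ
  · choose m hm using hA
    let b : ℕ → ℕ := fun n => Nat.rec 0 (fun _ c => max (c + 1) (m c)) n
    have hb_succ : ∀ n, b (n + 1) = max (b n + 1) (m (b n)) := fun _ => rfl
    have hb : StrictMono b := strictMono_nat_of_lt_succ fun n => by rw [hb_succ]; omega
    obtain ⟨hpart, hPinf⟩ := isPartitionOf_image_Ico hu hb rfl
    refine Or.inl ⟨_, hpart, hPinf, fun F hF => ⟨hfin b F hF, ?_⟩⟩
    obtain ⟨i, rfl⟩ := hF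
    rw [sUnion_image, ← univ_subset_iff, ← hm (b i)]
    exact biUnion_subset_biUnion_left (Ico_subset_Ico_right (by rw [hb_succ]; omega))
  · push Not at hA
    obtain ⟨N, hN⟩ := hA
    obtain ⟨g, hg⟩ := h (fun n k => ⋃ i ∈ Ico n k, u i)
      (fun n k => isOpen_biUnion fun i _ => hopen i)
      (fun n k l hkl => biUnion_subset_biUnion_left (Ico_subset_Ico_right hkl)) fun n x => by
        have : ((Iio n).image u).Finite := (finite_Iio n).image u
        obtain ⟨_, ⟨⟨i, rfl⟩, hxi⟩, hi⟩ := ((hlarge x).sdiff this).nonempty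
        exact ⟨i + 1, mem_biUnion (x := i)
          ⟨not_lt.1 fun hlt => hi ⟨i, hlt, rfl⟩, i.lt_succ_self⟩ hxi⟩
    obtain ⟨b, hb, hb0, hbF⟩ := exists_strictMono_frequently hg
    obtain ⟨hpart, -⟩ := isPartitionOf_image_Ico hu hb hb0
    have hω : ∀ F : Finset X, ∃ V ∈
        (sUnion '' range fun i => u '' Ico (b i) (b (i + 1))) \ {univ}, (F : Set X) ⊆ V := by
      intro F
      -- Intervals beyond `N` do not cover `X`, so their unions survive the removal of `X`.
      obtain ⟨j, hj, hF⟩ := frequently_atTop.1 (hbF F) N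
      refine ⟨⋃ i ∈ Ico (b j) (b (j + 1)), u i,
        ⟨⟨_, ⟨j, rfl⟩, sUnion_image _ _⟩, fun huniv => hN (b (j + 1)) ?_⟩, hF⟩
      rw [← univ_subset_iff, ← mem_singleton_iff.1 huniv]
      exact biUnion_subset_biUnion_left (Ico_subset_Ico_left (hj.trans hb.le_apply))
    refine Or.inr ⟨_, hpart, hfin b, ⟨⟨?_, ?_, ?_, fun h => h.2 rfl⟩, hω⟩⟩
    · exact ((countable_range _).image _).mono sdiff_subset
    · rintro _ ⟨⟨_, ⟨i, rfl⟩, rfl⟩, -⟩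
      rw [sUnion_image]
      exact isOpen_biUnion fun i _ => hopen i
    · refine eq_univ_of_forall fun x => ?_
      obtain ⟨V, hV, hx⟩ := hω {x}
      exact ⟨V, hV, hx (by simp)⟩

/-! ### Defeating strategies of player ONE -/

theorem exists_range_eq {U : Set (Set X)} (hU : IsOpenCover U) [Nonempty X] :
    ∃ e : ℕ → Set X, range e = U := by
  obtain ⟨x⟩ := ‹Nonempty X›
  obtain ⟨V, hV, -⟩ : x ∈ ⋃₀ U := hU.2.2.1 ▸ mem_univ x
  obtain ⟨e, he⟩ := hU.1.exists_eq_range ⟨V, hV⟩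
  exact ⟨e, he.symm⟩

open Classical in
/-- The replies of TWO when ONE follows `σ` and TWO answers the move `m` of the tree by the first
`m` members of the cover played, in the enumeration `e`. The argument lists the moves, last one
first; the result lists the replies, first one first. -/
noncomputable def replies {α : Type*} (σ : List (Finset (Set α)) → Set (Set α))
    (e : Set (Set α) → ℕ → Set α) : List ℕ → List (Finset (Set α))
  | [] => []
  | m :: t => replies σ e t ++ [(Finset.range m).image (e (σ (replies σ e t)))]

theorem length_replies {α : Type*} (σ : List (Finset (Set α)) → Set (Set α))
    (e : Set (Set α) → ℕ → Set α) (t : List ℕ) : (replies σ e t).length = t.length := by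
  induction t with
  | nil => rfl
  | cons m t ih => simp [replies, ih]

theorem LegalHistory.concat {α : Type*} {σ : List (Finset (Set α)) → Set (Set α)}
    {h : List (Finset (Set α))} (hh : LegalHistory σ h) {T : Finset (Set α)}
    (hT : (T : Set (Set α)) ⊆ σ h) : LegalHistory σ (h ++ [T]) := by
  intro i hi
  rcases lt_or_ge i h.length with hlt | hge
  · rw [List.getElem_append_left hlt, List.take_append_of_le_length hlt.le]
    exact hh i hlt
  · obtain rfl : i = h.length := by simp at hi; omega
    simpa using hT

/-- ONE has no winning strategy if the covers that ONE may play in inning `n` have at least `n`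
members through each point: TWO can make each point lie in `n` of the sets selected in inning `n`,
for infinitely many `n`, so that the selected sets form a large cover. -/
theorem SelectsFrequently.not_oneHasWinningStrategy [Nonempty X] (h : SelectsFrequently X)
    {A : ℕ → Set (Set (Set X))} (hA : ∀ n, ∀ U ∈ A n, IsOpenCover U)
    (hAn : ∀ n, ∀ U ∈ A n, ∀ x, ∃ S : Finset (Set X), n ≤ S.card ∧ ∀ V ∈ S, V ∈ U ∧ x ∈ V) :
    ¬ OneHasWinningStrategy A (omegaGroupableCovers X) := by
  classical
  rintro ⟨σ, hσ, hwin⟩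
  have he : ∀ U : Set (Set X), ∃ e : ℕ → Set X, IsOpenCover U → range e = U := fun U => by
    by_cases hU : IsOpenCover U
    · exact (exists_range_eq hU).imp fun e he _ => he
    · exact ⟨fun _ => ∅, fun h => absurd h hU⟩
  choose e he using he
  let R := replies σ e
  let reply : List ℕ → ℕ → Finset (Set X) := fun t m => (Finset.range m).image (e (σ (R t)))
  have hR : ∀ t, LegalHistory σ (R t) ∧ σ (R t) ∈ A t.length ∧ range (e (σ (R t))) = σ (R t) := by
    have key : ∀ t, LegalHistory σ (R t) →
        σ (R t) ∈ A t.length ∧ range (e (σ (R t))) = σ (R t) := fun t ht => by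
      have hm := hσ _ ht
      rw [length_replies] at hm
      exact ⟨hm, he _ (hA _ _ hm)⟩
    intro t
    induction t with
    | nil => exact ⟨by simp [LegalHistory, R, replies], key _ (by simp [LegalHistory, R, replies])⟩
    | cons m t ih =>
      have : LegalHistory σ (R (m :: t)) := ih.1.concat (by
        rw [Finset.coe_image]
        exact (image_subset_range _ _).trans ih.2.2.subset)
      exact ⟨this, key _ this⟩
  have hreply : ∀ t m, (reply t m : Set (Set X)) ⊆ σ (R t) := fun t m => by
    rw [Finset.coe_image]
    exact (image_subset_range _ _).trans (hR t).2.2.subset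
  have hcover : ∀ t, IsOpenCover (σ (R t)) := fun t => hA _ _ (hR t).2.1
  obtain ⟨f, hf⟩ := h.exists_branch
    (W := fun t m => {x | ∃ S ⊆ reply t m, t.length ≤ S.card ∧ ∀ V ∈ S, x ∈ V})
    (fun t m => isOpen_setOf_exists_subset_card _ (fun V hV => (hcover t).2.1 V (hreply t m hV)) _)
    (fun t m l hml x ⟨S, hS, hx⟩ =>
      ⟨S, hS.trans (Finset.image_subset_image (Finset.range_mono hml)), hx⟩)
    (fun t x => by
      obtain ⟨S, hc, hS⟩ := hAn _ _ (hR t).2.1 x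
      have hmem : ∀ V ∈ S, ∃ i, e (σ (R t)) i = V := fun V hV => by
        have := (hS V hV).1
        rwa [← (hR t).2.2] at this
      choose! i hi using hmem
      refine ⟨S.sup i + 1, S, fun V hV => Finset.mem_image.2 ⟨i V, ?_, hi V hV⟩, hc,
        fun V hV => (hS V hV).2⟩
      exact Finset.mem_range.2 (Nat.lt_succ_of_le (Finset.le_sup (f := i) hV)))
  let T : ℕ → Finset (Set X) := fun n => reply (revPrefix f n) (f n)
  have hT : ∀ n, (List.ofFn fun i : Fin n => T i) = R (revPrefix f n) := fun n => by
    induction n with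
    | zero => rfl
    | succ n ih =>
      rw [List.ofFn_succ']
      simp only [Fin.val_castSucc, Fin.val_last, List.concat_eq_append]
      rw [ih]
      rfl
  have hinf : ∀ x, {V ∈ ⋃ n, (T n : Set (Set X)) | x ∈ V}.Infinite := fun x hfin => by
    obtain ⟨n, hn, S, hS, hc, hx⟩ := frequently_atTop.1 (hf x) (hfin.toFinset.card + 1)
    have hsub : S ⊆ hfin.toFinset := fun V hV => by
      rw [Finite.mem_toFinset]
      exact ⟨mem_iUnion.2 ⟨n, hS hV⟩, hx V hV⟩
    have := Finset.card_le_card hsub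
    rw [length_revPrefix] at hc
    omega
  refine hwin T (fun n => hT n ▸ hreply _ _) (h.largeCovers_subset ⟨⟨?_, ?_, ?_, ?_⟩, hinf⟩)
  · exact countable_iUnion fun n => (T n).countable_toSet
  · intro V hV
    obtain ⟨n, hn⟩ := mem_iUnion.1 hV
    exact (hcover _).2.1 V (hreply _ _ hn)
  · refine eq_univ_of_forall fun x => ?_
    obtain ⟨V, hV, hx⟩ := (hinf x).nonempty
    exact ⟨V, hV, hx⟩
  · intro hV
    obtain ⟨n, hn⟩ := mem_iUnion.1 hV
    exact (hcover _).2.2.2 (hreply _ _ hn)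

theorem OneHasWinningStrategy.mono {α : Type*} {A A' : ℕ → Set (Set (Set α))}
    {B : Set (Set (Set α))} (hAA' : ∀ n, A n ⊆ A' n) (h : OneHasWinningStrategy A B) :
    OneHasWinningStrategy A' B :=
  let ⟨σ, hσ, hwin⟩ := h
  ⟨σ, fun t ht => hAA' _ (hσ t ht), hwin⟩

/-! ### Recovering the selection hypothesis from the game -/

/-- Each member of `T n` is contained in some member of the increasing family `B m`, for every
`m ≤ n`. If `⋃ n, T n` is partitioned into finite groups, then the union of a group is contained
in a member of `B m` for the first `m` such that the group meets `T m`. Only finitely many groups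
meet `T m`, so one member of `B m` serves for all of them. -/
theorem exists_forall_sUnion_subset {α : Type*} {B : ℕ → ℕ → Set α} (hB : ∀ m, Monotone (B m))
    {T : ℕ → Finset (Set α)} (hT : ∀ n, ∀ V ∈ T n, ∀ m ≤ n, ∃ k, V ⊆ B m k)
    {P : Set (Set (Set α))} (hP : IsPartitionOf P (⋃ n, (T n : Set (Set α))))
    (hPfin : ∀ G ∈ P, G.Finite) :
    ∃ g : ℕ → ℕ, ∀ G ∈ P, ∃ m, ⋃₀ G ⊆ B m (g m) := by
  obtain ⟨hempty, hdisj, hunion⟩ := hP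
  have hmeet : ∀ m, {G ∈ P | (G ∩ T m).Nonempty}.Finite := fun m => by
    have hsub : ∀ G ∈ {G ∈ P | (G ∩ T m).Nonempty}, ∃ V ∈ (T m : Set (Set α)), V ∈ G :=
      fun G ⟨_, V, hVG, hVT⟩ => ⟨V, hVT, hVG⟩
    choose! v hvT hvG using hsub
    refine Finite.of_finite_image ((T m).finite_toSet.subset (image_subset_iff.2 hvT)) ?_
    intro G hG H hH hGH
    by_contra hne
    exact disjoint_left.1 (hdisj hG.1 hH.1 hne) (hvG G hG) (hGH ▸ hvG H hH)
  have hbound : ∀ m, ∀ G ∈ P, (∀ n < m, ¬ (G ∩ T n).Nonempty) → ∃ k, ⋃₀ G ⊆ B m k := by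
    intro m G hG hm
    have hV : ∀ V ∈ G, ∃ k, V ⊆ B m k := fun V hV => by
      obtain ⟨n, hn⟩ := mem_iUnion.1 (hunion ▸ mem_sUnion_of_mem hV hG)
      exact hT n V hn m (not_lt.1 fun hlt => hm n hlt ⟨V, hV, hn⟩)
    choose! k hk using hV
    refine ⟨(hPfin G hG).toFinset.sup k, sUnion_subset fun V hV => (hk V hV).trans ?_⟩
    exact hB m (Finset.le_sup (f := k) (by simpa using hV))
  choose! k hk using hbound
  refine ⟨fun m => (hmeet m).toFinset.sup (k m), fun G hG => ?_⟩
  classical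
  have hex : ∃ m, (G ∩ T m).Nonempty := by
    obtain ⟨V, hV⟩ := nonempty_iff_ne_empty.2 fun h => hempty (h ▸ hG)
    obtain ⟨n, hn⟩ := mem_iUnion.1 (hunion ▸ mem_sUnion_of_mem hV hG)
    exact ⟨n, V, hV, hn⟩
  refine ⟨Nat.find hex, (hk _ G hG fun n hn => Nat.find_min hex hn).trans (hB _ ?_)⟩
  exact Finset.le_sup (f := k (Nat.find hex)) (by simpa using ⟨hG, Nat.find_spec hex⟩)

/-- With `B n` the increasing cover by finite unions of the `n`-th given cover, ONE plays the sets
`⋂ i ≤ n, B i k` in inning `n`. Any grouping that makes the replies of TWO `ω`-groupable yields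
the selection. A group whose union is `X` cannot occur, since no `B n k` is `X`. -/
theorem ufin_of_not_oneHasWinningStrategy [Nonempty X]
    (h : ¬ OneHasWinningStrategy (fun _ : ℕ => omegaCovers X) (omegaGroupableCovers X)) :
    Ufin (gammaCovers X) (omegaCovers X) := by
  intro U hU
  choose e he using fun n => exists_range_eq (hU n).1.1
  let S : ℕ → ℕ → Set (Set X) := fun n k => e n '' Iio k
  let B : ℕ → ℕ → Set X := fun n k => ⋃₀ S n k
  have hS : ∀ n k, (S n k).Finite ∧ S n k ⊆ U n := fun n k =>
    ⟨(finite_Iio k).image _, (image_subset_range _ _).trans (he n).subset⟩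
  have hBopen : ∀ n k, IsOpen (B n k) := fun n k =>
    isOpen_sUnion fun V hV => (hU n).1.1.2.1 V ((hS n k).2 hV)
  have hBmono : ∀ n, Monotone (B n) := fun n k l hkl =>
    sUnion_subset_sUnion (image_mono (Iio_subset_Iio hkl))
  have hBne : ∀ n k, B n k ≠ univ := fun n k hk =>
    (hU n).2 ⟨S n k, (hS n k).2, (hS n k).1, hk⟩
  have hBcov : ∀ n x, ∃ k, x ∈ B n k := fun n x => by
    obtain ⟨V, hV, hx⟩ : x ∈ ⋃₀ U n := (hU n).1.1.2.2.1 ▸ mem_univ x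
    rw [← he n] at hV
    obtain ⟨i, rfl⟩ := hV
    exact ⟨i + 1, _, ⟨i, i.lt_succ_self, rfl⟩, hx⟩
  -- It suffices to select the sets `B n (g n)` so that each finite set lies in one of them.
  suffices hg : ∃ g : ℕ → ℕ, ∀ F : Finset X, ∃ n, (F : Set X) ⊆ B n (g n) by
    obtain ⟨g, hg⟩ := hg
    refine ⟨fun n => S n (g n), fun n => hS n _, ⟨countable_range _, ?_, ?_, ?_⟩, fun F => ?_⟩
    · rintro _ ⟨n, rfl⟩
      exact hBopen n _
    · refine eq_univ_of_forall fun x => ?_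
      obtain ⟨n, hn⟩ := hg {x}
      exact ⟨_, ⟨n, rfl⟩, hn (by simp)⟩
    · rintro ⟨n, hn⟩
      exact hBne n _ hn
    · obtain ⟨n, hn⟩ := hg F
      exact ⟨_, ⟨n, rfl⟩, hn⟩
  let C : ℕ → ℕ → Set X := fun n k => ⋂ i ∈ Finset.range (n + 1), B i k
  have hCB : ∀ n k, ∀ m ≤ n, C n k ⊆ B m k := fun n k m hm =>
    biInter_subset_of_mem (Finset.mem_coe.2 (Finset.mem_range.2 (Nat.lt_succ_of_le hm)))
  have hC : ∀ n, range (C n) ∈ omegaCovers X := fun n => by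
    have hF : ∀ F : Finset X, ∃ V ∈ range (C n), (F : Set X) ⊆ V := fun F => by
      choose k hk using fun i => exists_subset_of_monotone (hBmono i) (hBcov i) F
      refine ⟨_, ⟨(Finset.range (n + 1)).sup k, rfl⟩, subset_iInter₂ fun i hi => ?_⟩
      exact (hk i).trans (hBmono i (Finset.le_sup hi))
    refine ⟨⟨countable_range _, ?_, eq_univ_of_forall fun x => ?_, ?_⟩, hF⟩
    · rintro _ ⟨k, rfl⟩
      exact isOpen_biInter_finset fun i _ => hBopen i k
    · obtain ⟨V, hV, hx⟩ := hF {x}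
      exact ⟨V, hV, hx (by simp)⟩
    · rintro ⟨k, hk⟩
      exact hBne 0 k (univ_subset_iff.1 (hk ▸ hCB n k 0 n.zero_le))
  by_contra hno
  refine h ⟨fun t => range (C t.length), fun t _ => hC _, fun T hT hgp => hno ?_⟩
  have hTB : ∀ n, ∀ V ∈ T n, ∀ m ≤ n, ∃ k, V ⊆ B m k := fun n V hV m hm => by
    obtain ⟨k, rfl⟩ := hT n hV
    exact ⟨k, hCB _ k m (by simpa using hm)⟩
  rcases hgp.2 with ⟨P, hP, hinf, hPG⟩ | ⟨P, hP, hPfin, hPω⟩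
  · obtain ⟨g, hg⟩ := exists_forall_sUnion_subset hBmono hTB hP fun G hG => (hPG G hG).1
    obtain ⟨G, hG⟩ := hinf.nonempty
    obtain ⟨m, hm⟩ := hg G hG
    exact absurd (univ_subset_iff.1 ((hPG G hG).2 ▸ hm)) (hBne m _)
  · obtain ⟨g, hg⟩ := exists_forall_sUnion_subset hBmono hTB hP hPfin
    refine ⟨g, fun F => ?_⟩
    obtain ⟨_, ⟨⟨G, hG, rfl⟩, -⟩, hF⟩ := hPω.2 F
    exact (hg G hG).imp fun m hm => hF.trans hm

end CoverGames

theorem mainTheorem4 (X : Type*) [TopologicalSpace X] [Infinite X] :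
    List.TFAE
      [CoverGames.Ufin (CoverGames.gammaCovers X) (CoverGames.omegaCovers X),
        ¬ CoverGames.OneHasWinningStrategy (fun _ : ℕ => CoverGames.omegaCovers X)
          (CoverGames.omegaGroupableCovers X),
        ¬ CoverGames.OneHasWinningStrategy (fun _ : ℕ => CoverGames.largeCovers X)
          (CoverGames.omegaGroupableCovers X),
        ¬ CoverGames.OneHasWinningStrategy (fun n : ℕ => CoverGames.nCovers X n)
          (CoverGames.omegaGroupableCovers X)] := by
  tfae_have 1 → 3 := fun h =>
    (CoverGames.selectsFrequently_of_ufin h).not_oneHasWinningStrategy (fun _ _ hU => hU.1)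
      fun n U hU x => by
        obtain ⟨S, hS, hc⟩ := (hU.2 x).exists_subset_card_eq n
        exact ⟨S, hc.ge, fun V hV => hS hV⟩
  tfae_have 1 → 4 := fun h =>
    (CoverGames.selectsFrequently_of_ufin h).not_oneHasWinningStrategy (fun _ _ hU => hU.1)
      fun _ _ hU => CoverGames.exists_finset_of_mem_nCovers hU
  tfae_have 3 → 2 := mt (CoverGames.OneHasWinningStrategy.mono fun _ =>
    CoverGames.omegaCovers_subset_largeCovers)
  tfae_have 4 → 2 := mt (CoverGames.OneHasWinningStrategy.mono
    CoverGames.omegaCovers_subset_nCovers)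
  tfae_have 2 → 1 := CoverGames.ufin_of_not_oneHasWinningStrategy
  tfae_finish
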